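/- **Setting.** Types are $\tau ::= o \mid \tau\to\tau$; every type is uniquely $\tau_1\to\dots\to\tau_k\to o$, with arity $k$; $\mathrm{order}(o)=0$ and $\mathrm{order}(\tau_1\to\tau_2)=\max(\mathrm{order}(\tau_1)+1,\mathrm{order}(\tau_2))$. For a set $\Gamma$ of typed symbols, $\mathcal T(\Gamma)$ is the set of simply typed applicative terms over $\Gamma$. A higher-order recursion scheme (HORS) $G$ consists of a finite set $\Sigma$ of terminals, whose types have order at most $1$, a finite set $\mathcal N$ of typed non-terminals, an initial non-terminal $S:o$, and, for each $F:\tau_1\to\dots\to\tau_k\to o$ in $\mathcal N$, exactly one rule $F\,x_1\cdots x_k\to e$ with $e:o$ a term over $\Sigma\uplus\mathcal N\uplus\{x_1:\tau_1,\dots,x_k:\tau_k\}$. A redex is a term $F\,s_1\cdots s_k:o$ of $\mathcal T(\Sigma\uplus\mathcal N)$ with $F\in\mathcal N$. One IO step $t\to_{IO}t'$ replaces one occurrence in $t$ of a redex $F\,s_1\cdots s_k$, such that no $s_j$ contains a redex as a subterm, by $e[x_1\mapsto s_1,\dots,x_k\mapsto s_k]$. For a ground term $t$, $t^\bot$ is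 the tree over $\Sigma\uplus\{\bot:o\}$ defined by $(F\,t_1\cdots t_k)^\bot=\bot$ for $F\in\mathcal N$ and $(a\,t_1\cdots t_k)^\bot=a\,t_1^\bot\cdots t_k^\bot$ for $a\in\Sigma$. Finite and infinite trees are ordered by $s\sqsubseteq s'$ iff $s'$ arises from $s$ by replacing leaves labelled $\bot$ by trees. The IO value tree of a ground term $t$ is the supremum of $\{s^\bot : t\to_{IO}^* s\}$. An IO derivation from $r$ is a finite or infinite sequence $r=t_0\to_{IO}t_1\to_{IO}\cdots$; it is complete if it is infinite or its last term admits no IO step; it produces the supremum of the trees $t_n^\bot$. For $t\in\mathcal T(\Sigma\uplus\mathcal N)$ of any type: * $\mathcal P_\infty(t)$: $t$ contains, as a subterm, a redex $r$ such that every complete IO derivation from $r$ that produces the IO value tree of $r$ is infinite; * $\mathcal P_\bot(t)$: $t$ has type $o$ and its IO value tree is $\bot$. **Type system.** Let $Q=\{q_\bot,q_\infty\}$, $(o)^{atom}=Q$, $(\tau_1\to\tau_2)^{atom}=\{q_\infty\}\uplus\{\sigma\to\theta : \sigma\in(\tau_1)^\wedge,\ \theta\in(\tau_2)^{atom}\}$,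 and let $(\tau)^\wedge$ be the set of all (finite, possibly empty) conjunctions $\bigwedge\{\theta_1,\dots,\theta_i\}$, i.e. sets, of elements of $(\tau)^{atom}$; $\theta$ is identified with $\bigwedge\{\theta\}$. An environment $\Theta$ assigns elements of $(\tau)^\wedge$ to symbols of type $\tau$ (non-terminals and variables). All mappings are well typed: a term of type $\tau$ is judged only with elements of $(\tau)^{atom}$ and $(\tau)^\wedge$. Judgements are derived by the following rules. * $\Theta\vdash t\triangleright\bigwedge\{\theta_1,\dots,\theta_n\}$ if $\Theta\vdash t\triangleright\theta_i$ for all $i$. * $\Theta\vdash\alpha\triangleright\theta$ if $\theta$ is one of the conjuncts of $\Theta(\alpha)$, for a non-terminal or variable $\alpha$. * $\Theta\vdash a\triangleright\sigma_1\to\dots\to\sigma_i\to q_\infty$ for $a\in\Sigma$, $i\le\mathrm{arity}(a)$, if $\sigma_j=q_\infty$ for some $j\le i$. * $\Theta\vdash t_1\,t_2\triangleright\theta$ if $\Theta\vdash t_1\triangleright\sigma\to\theta$ and $\Theta\vdash t_2\triangleright\sigma$. * $\Theta\vdash t\triangleright q_\infty\to q_\infty$ for every $t$ of a type $\tau_1\to\tau_2$.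 * $\Theta\vdash t_1\,t_2\triangleright q_\infty$ if $\Theta\vdash t_1\triangleright q_\infty$. Write $\vdash(G,t)\triangleright\sigma$ if there is an environment $\Theta$ with domain $\mathcal N$ and $\Theta(F)\in(\tau)^\wedge$ for all $F:\tau$ in $\mathcal N$, such that $\Theta\vdash t\triangleright\sigma$ and, for each rule $F\,x_1\cdots x_k\to e$: whenever $\Theta\vdash F\triangleright\sigma_1\to\dots\to\sigma_i\to q$ with $i\le k$ and $q\in Q$, either $q_\infty\in\sigma_j$ for some $j\le i$, or $i=k$ and $\Theta,x_1\triangleright\sigma_1,\dots,x_k\triangleright\sigma_k\vdash e\triangleright q$. **Theorem (Soundness and Completeness).** Let $G$ be a HORS and let $t\in\mathcal T(\Sigma\uplus\mathcal N)$ be a term of any type. Then $$\vdash(G,t)\triangleright q_\infty \iff \mathcal P_\infty(t)\qquad\text{and}\qquad \vdash(G,t)\triangleright q_\bot \iff \mathcal P_\bot(t).$$ (If $t$ does not have type $o$, then $q_\bot$ is not a mapping of its type and $\vdash(G,t)\triangleright q_\bot$ does not hold.) -/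

import Mathlib

namespace RecScheme

universe u

/-! ### Types and terms -/

/-- Simple types over the single ground type `o`. -/
inductive Ty : Type
  | o : Ty
  | arr : Ty → Ty → Ty

/-- The arity `k` of `τ₁ → ⋯ → τₖ → o`. -/
def Ty.arity : Ty → ℕ
  | .o => 0
  | .arr _ b => b.arity + 1

def Ty.order : Ty → ℕ
  | .o => 0
  | .arr a b => max (a.order + 1) b.order

/-- `Term Γ τ` is the set of applicative terms of type `τ` over the typed symbols `Γ`, where `Γ τ`
is the set of symbols of type `τ`. -/
inductive Term (Γ : Ty → Type u) : Ty → Type u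
  | sym {τ : Ty} : Γ τ → Term Γ τ
  | app {τ₁ τ₂ : Ty} : Term Γ (.arr τ₁ τ₂) → Term Γ τ₁ → Term Γ τ₂

/-- `Param τ α`: the formal parameters of type `α` of a symbol of type `τ`. For
`τ = τ₁ → ⋯ → τₖ → o` these are the variables `x₁ : τ₁, …, xₖ : τₖ`. -/
inductive Param : Ty → Ty → Type
  | zero {a b : Ty} : Param (.arr a b) a
  | succ {a b α : Ty} : Param b α → Param (.arr a b) α

/-- No variables at all. -/
def NoVar : Ty → Type := fun _ => Empty

namespace Term

variable {Γ : Ty → Type u}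

/-- `t.applyArgs s` is the ground term `t s₁ ⋯ sₖ`. -/
def applyArgs : {τ : Ty} → Term Γ τ → (∀ α, Param τ α → Term Γ α) → Term Γ .o
  | .o, t, _ => t
  | .arr a _, t, s => applyArgs (.app t (s a .zero)) (fun α x => s α (.succ x))

/-- `Subterm r t`: the term `r` is a subterm of `t`. -/
inductive Subterm : {α τ : Ty} → Term Γ α → Term Γ τ → Prop
  | refl {τ : Ty} (t : Term Γ τ) : Subterm t t
  | left {α a b : Ty} {r : Term Γ α} {t : Term Γ (.arr a b)} (s : Term Γ a) :
      Subterm r t → Subterm r (.app t s)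
  | right {α a b : Ty} {r : Term Γ α} (t : Term Γ (.arr a b)) {s : Term Γ a} :
      Subterm r s → Subterm r (.app t s)

/-- The head symbol of a term, with its type. -/
def head : {τ : Ty} → Term Γ τ → Σ α, Γ α
  | _, .sym c => ⟨_, c⟩
  | _, .app t _ => t.head

/-- The list of arguments of the head symbol, with their types. -/
def args : {τ : Ty} → Term Γ τ → List (Σ α, Term Γ α)
  | _, .sym _ => []
  | _, .app t s => t.args ++ [⟨_, s⟩]

theorem arity_head : {τ : Ty} → (t : Term Γ τ) → t.head.1.arity = t.args.length + τ.arity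
  | _, .sym c => by simp [head, args]
  | _, .app t s => by
      have h := arity_head t
      simp only [head, args, List.length_append, List.length_singleton, Ty.arity] at h ⊢
      omega

theorem order_le_head : {τ : Ty} → (t : Term Γ τ) → τ.order ≤ t.head.1.order
  | _, .sym c => le_refl _
  | _, .app t s => by
      have h := order_le_head t
      simp only [head, Ty.order] at h ⊢
      omega

theorem args_ground : {τ : Ty} → (t : Term Γ τ) → t.head.1.order ≤ 1 →
    ∀ p ∈ t.args, p.1 = .o
  | _, .sym c => by simp [args]
  | _, .app (τ₁ := a) t s => by
      intro h p hp
      simp only [args, List.mem_append, List.mem_singleton] at hp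
      rcases hp with hp | rfl
      · exact args_ground t h p hp
      · have h2 := (order_le_head t).trans h
        cases a with
        | o => rfl
        | arr a₁ a₂ =>
          simp only [Ty.order] at h2
          omega

end Term

/-! ### Recursion schemes -/

/-- The typed symbols available in a term: terminals, non-terminals, and variables from `X`. -/
inductive Symbol (T N : Ty → Type u) (X : Ty → Type) : Ty → Type u
  | terminal {τ : Ty} : T τ → Symbol T N X τ
  | nonterminal {τ : Ty} : N τ → Symbol T N X τ
  | var {τ : Ty} : X τ → Symbol T N X τ

/-- A higher-order recursion scheme. The right-hand side of the unique rule
`F x₁ ⋯ xₖ → e` of a non-terminal `F : τ` is `rule F`, a ground term over the terminals, the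
non-terminals and the variables `x₁, …, xₖ`. -/
structure HORS where
  terminal : Ty → Type u
  nonterminal : Ty → Type u
  finite_terminal : Finite (Σ τ, terminal τ)
  finite_nonterminal : Finite (Σ τ, nonterminal τ)
  order_terminal : ∀ {τ : Ty}, terminal τ → τ.order ≤ 1
  rule : ∀ {τ : Ty}, nonterminal τ → Term (Symbol terminal nonterminal (Param τ)) .o
  start : nonterminal .o

namespace HORS

variable (G : HORS.{u})

/-- Terms over the terminals, the non-terminals and the variables `X`. -/
abbrev OpenTerm (X : Ty → Type) (τ : Ty) : Type u :=
  Term (Symbol G.terminal G.nonterminal X) τ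

/-- Terms over the terminals and the non-terminals. -/
abbrev CTerm (τ : Ty) : Type u := G.OpenTerm NoVar τ

variable {G}

/-- Simultaneous substitution of terms for variables. -/
def subst {X Y : Ty → Type} (s : ∀ α, X α → G.OpenTerm Y α) :
    {τ : Ty} → G.OpenTerm X τ → G.OpenTerm Y τ
  | _, .sym (.terminal a) => .sym (.terminal a)
  | _, .sym (.nonterminal F) => .sym (.nonterminal F)
  | _, .sym (.var x) => s _ x
  | _, .app t₁ t₂ => .app (subst s t₁) (subst s t₂)

/-- A redex is a ground term `F s₁ ⋯ sₖ` whose head `F` is a non-terminal. -/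
def IsRedex (r : G.CTerm .o) : Prop :=
  ∃ (τ : Ty) (F : G.nonterminal τ) (s : ∀ α, Param τ α → G.CTerm α),
    r = (Term.sym (.nonterminal F)).applyArgs s

/-- No subterm of `t` is a redex. -/
def RedexFree {τ : Ty} (t : G.CTerm τ) : Prop :=
  ∀ r : G.CTerm .o, IsRedex r → ¬ r.Subterm t

/-- Innermost-outermost rewriting: a redex `F s₁ ⋯ sₖ`, anywhere in the term, is rewritten by the
rule of `F`, provided that no `sⱼ` contains a redex. -/
inductive IOStep : {τ : Ty} → G.CTerm τ → G.CTerm τ → Prop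
  | redex {τ : Ty} (F : G.nonterminal τ) (s : ∀ α, Param τ α → G.CTerm α)
      (hs : ∀ α x, RedexFree (s α x)) :
      IOStep ((Term.sym (.nonterminal F)).applyArgs s) (subst s (G.rule F))
  | left {a b : Ty} {t t' : G.CTerm (.arr a b)} (s : G.CTerm a) :
      IOStep t t' → IOStep (.app t s) (.app t' s)
  | right {a b : Ty} (t : G.CTerm (.arr a b)) {s s' : G.CTerm a} :
      IOStep s s' → IOStep (.app t s) (.app t s')

/-! ### Trees -/

/-- Node labels: terminals and the fresh symbol `⊥` of type `o`. -/
inductive Label (G : HORS.{u}) : Type u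
  | bot : Label G
  | sym {τ : Ty} : G.terminal τ → Label G

def Label.arity : Label G → ℕ
  | .bot => 0
  | .sym (τ := τ) _ => τ.arity

/-- Finite or infinite ranked trees over the terminals and `⊥`: labellings of a non-empty
prefix-closed set of positions. The children of a node with a label of arity `m` are numbered
`0, …, m - 1`. -/
@[ext]
structure Tree (G : HORS.{u}) where
  label : List ℕ → Option (Label G)
  root : (label []).isSome
  prefix_closed : ∀ u j, (label (u ++ [j])).isSome → (label u).isSome
  children : ∀ u l, label u = some l → ∀ j, (label (u ++ [j])).isSome ↔ j < l.arity

/-- `s ≤ t` if `t` is obtained from `s` by replacing leaves `⊥` of `s` by trees. -/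
instance : PartialOrder (Tree G) where
  le s t := ∀ u l, s.label u = some l → ∃ l', t.label u = some l' ∧ (l = .bot ∨ l = l')
  le_refl s u l h := ⟨l, h, Or.inr rfl⟩
  le_trans s t r hst htr u l h := by
    obtain ⟨l', h', hl⟩ := hst u l h
    obtain ⟨l'', h'', hl'⟩ := htr u l' h'
    refine ⟨l'', h'', ?_⟩
    rcases hl with hl | rfl
    · exact Or.inl hl
    · exact hl'
  le_antisymm s t hst hts := by
    ext1
    funext u
    cases hs : s.label u with
    | none =>
      cases ht : t.label u with
      | none => rfl
      | some l =>
        obtain ⟨l', h', -⟩ := hts u l ht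
        rw [hs] at h'
        cases h'
    | some l =>
      obtain ⟨l', h', hl⟩ := hst u l hs
      obtain ⟨l'', h'', hl'⟩ := hts u l' h'
      rw [hs] at h''
      cases h''
      rw [h']
      rcases hl with rfl | rfl
      · rcases hl' with rfl | rfl <;> rfl
      · rfl

/-- The tree whose only node is labelled `⊥`. -/
instance : Bot (Tree G) where
  bot :=
    { label := fun u => if u = [] then some .bot else none
      root := by simp
      prefix_closed := by intro u j; simp
      children := by
        intro u l h j
        have hl : l = .bot := by
          by_cases hu : u = []
          · simpa [hu, eq_comm] using h
          · simp [hu] at h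
        subst hl
        simp [Label.arity] }

/-- The root label of the `⊥`-transform of a term with the given head. -/
def headLabel {X : Ty → Type} : (Σ α, Symbol G.terminal G.nonterminal X α) → Label G
  | ⟨_, .terminal a⟩ => .sym a
  | ⟨_, .nonterminal _⟩ => .bot
  | ⟨_, .var _⟩ => .bot

/-- The label at a position of the tree `t^⊥`, where `(F t₁ ⋯ tₖ)^⊥ = ⊥` for a non-terminal `F` and
`(a t₁ ⋯ tₖ)^⊥ = a t₁^⊥ ⋯ tₖ^⊥` for a terminal `a`. -/
def botLabel : List ℕ → (Σ α, G.CTerm α) → Option (Label G)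
  | [], t => some (headLabel t.2.head)
  | j :: u, t =>
    match headLabel t.2.head with
    | .bot => none
    | .sym _ => t.2.args[j]?.bind (botLabel u)

theorem headLabel_sym {X : Ty → Type} {p : Σ α, Symbol G.terminal G.nonterminal X α} {τ : Ty}
    {a : G.terminal τ} (h : headLabel p = .sym a) : p.1 = τ := by
  rcases p with ⟨α, _ | _ | _⟩ <;> simp only [headLabel] at h <;> cases h
  rfl

theorem botLabel_prefix (u : List ℕ) (j : ℕ) : ∀ t : (Σ α, G.CTerm α),
    (botLabel (u ++ [j]) t).isSome → (botLabel u t).isSome := by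
  induction u with
  | nil => intro t _; simp [botLabel]
  | cons i u ih =>
    intro t
    simp only [List.cons_append, botLabel]
    cases headLabel t.2.head with
    | bot => simp
    | sym a =>
      cases t.2.args[i]? with
      | none => simp
      | some p => simpa using ih p

theorem botLabel_children (u : List ℕ) : ∀ (t : (Σ α, G.CTerm α)), t.1 = .o →
    ∀ l, botLabel u t = some l → ∀ j, (botLabel (u ++ [j]) t).isSome ↔ j < l.arity := by
  induction u with
  | nil =>
    intro t ht l hl j
    simp only [botLabel, Option.some.injEq] at hl
    simp only [List.nil_append, botLabel]
    rw [hl]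
    cases l with
    | bot => simp [Label.arity]
    | sym a =>
      have h1 := headLabel_sym hl
      have h2 := t.2.arity_head
      have h3 : t.1.arity = 0 := by rw [ht]; rfl
      rw [h1, h3, add_zero] at h2
      simp only [Label.arity, h2]
      by_cases hj : j < t.2.args.length
      · simp [hj]
      · simp [hj]
  | cons i u ih =>
    intro t ht l
    simp only [List.cons_append, botLabel]
    cases h : headLabel t.2.head with
    | bot => simp
    | sym a =>
      cases hp : t.2.args[i]? with
      | none => simp
      | some p =>
        refine ih p ?_ l
        refine t.2.args_ground ?_ p (List.mem_of_getElem? hp)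
        rw [headLabel_sym h]
        exact G.order_terminal a

/-- The `⊥`-transform of a ground term, as a tree. -/
def botTree (t : G.CTerm .o) : Tree G where
  label u := botLabel u ⟨.o, t⟩
  root := by simp [botLabel]
  prefix_closed u j h := botLabel_prefix u j _ h
  children u l h j := botLabel_children u _ rfl l h j

/-- `V` is the IO value tree of the ground term `t`, that is, of the scheme that behaves as `G` but
starts its derivations with `t`: the supremum of the trees `s^⊥` with `t →*_IO s`. -/
def IsIOValueTree (t : G.CTerm .o) (V : Tree G) : Prop :=
  IsLUB {T : Tree G | ∃ s : G.CTerm .o, Relation.ReflTransGen IOStep t s ∧ T = botTree s} V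

/-! ### IO derivations and the two properties of terms -/

/-- A finite or infinite IO derivation from `r`: the `n`-th term is `seq n`, and `seq n = none` if
the derivation has ended before. -/
structure IODerivation (r : G.CTerm .o) where
  seq : ℕ → Option (G.CTerm .o)
  seq_zero : seq 0 = some r
  step : ∀ n t', seq (n + 1) = some t' → ∃ t, seq n = some t ∧ IOStep t t'

namespace IODerivation

variable {r : G.CTerm .o} (d : IODerivation r)

def Infinite : Prop := ∀ n, (d.seq n).isSome

/-- The derivation does not stop at a term that can still be rewritten. -/
def Maximal : Prop := ∀ n t, d.seq n = some t → d.seq (n + 1) = none → ∀ t', ¬ IOStep t t'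

/-- `V` is the limit tree of the derivation. -/
def IsLimit (V : Tree G) : Prop :=
  IsLUB {T : Tree G | ∃ n t, d.seq n = some t ∧ T = botTree t} V

/-- The limit tree of the derivation is the IO value tree of its first term. -/
def ProducesValueTree : Prop := ∃ V : Tree G, IsIOValueTree r V ∧ d.IsLimit V

end IODerivation

/-- `t`, of any type, contains a redex `r` such that every (complete) IO derivation from `r` that
produces the IO value tree of `r` is infinite. -/
def PInf {τ : Ty} (t : G.CTerm τ) : Prop :=
  ∃ r : G.CTerm .o, IsRedex r ∧ r.Subterm t ∧
    ∀ d : IODerivation r, d.Maximal → d.ProducesValueTree → d.Infinite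

/-- `t` has type `o` and its IO value tree is `⊥`. -/
def PBot : {τ : Ty} → G.CTerm τ → Prop
  | .o, t => IsIOValueTree t ⊥
  | .arr _ _, _ => False

end HORS

/-! ### The type system -/

inductive Q : Type
  | bot : Q
  | inf : Q

/-- The atomic mappings of a type: `Q` at type `o`, and at type `τ₁ → τ₂` either `q_∞` (`none`) or
`σ → θ` with `σ` a conjunctive mapping of type `τ₁` and `θ` an atomic mapping of type `τ₂`. -/
def Atom : Ty → Type
  | .o => Q
  | .arr a b => Option (Set (Atom a) × Atom b)

/-- A conjunctive mapping `⋀{θ₁, …, θᵢ}` is a set of atomic mappings; every such set is finite, see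
the instance below. -/
abbrev Conj (τ : Ty) : Type := Set (Atom τ)

instance : Finite Q :=
  Finite.of_injective (fun q : Q => match q with | .bot => true | .inf => false) (by
    intro a b h
    cases a <;> cases b <;> simp_all)

instance instFiniteAtom : (τ : Ty) → Finite (Atom τ)
  | .o => inferInstanceAs (Finite Q)
  | .arr a b =>
    have := instFiniteAtom a
    have := instFiniteAtom b
    inferInstanceAs (Finite (Option (Set (Atom a) × Atom b)))

namespace Atom

/-- `q ∈ Q` as an atomic mapping of type `o`. -/
def base (q : Q) : Atom .o := q

/-- `q_∞` as an atomic mapping of any type. -/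
def inf : (τ : Ty) → Atom τ
  | .o => Q.inf
  | .arr _ _ => none

/-- The atomic mapping `σ → θ`. -/
def arrow {a b : Ty} (σ : Conj a) (θ : Atom b) : Atom (.arr a b) := some (σ, θ)

/-- The atom `q` as an atomic mapping of type `τ`, if it is one: `q_∞` belongs to every type, and
`q_⊥` to the type `o` only. -/
def ofQ : Q → (τ : Ty) → Option (Atom τ)
  | .inf, τ => some (inf τ)
  | .bot, .o => some (base .bot)
  | .bot, .arr _ _ => none

/-- The final atom `q` of `σ₁ → ⋯ → σᵢ → q`. -/
def target : {τ : Ty} → Atom τ → Q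
  | .o, q => q
  | .arr _ _, none => .inf
  | .arr _ _, some p => target p.2

/-- Some `σⱼ` in `σ₁ → ⋯ → σᵢ → q` satisfies `P`. -/
def ExistsArg (P : ∀ α, Conj α → Prop) : {τ : Ty} → Atom τ → Prop
  | .o, _ => False
  | .arr _ _, none => False
  | .arr a _, some p => P a p.1 ∨ ExistsArg P p.2

/-- The atomic mapping `σ₁ → ⋯ → σₖ → q` of type `τ₁ → ⋯ → τₖ → o`, with all `k` arguments. -/
def full : (τ : Ty) → (∀ α, Param τ α → Conj α) → Q → Atom τ
  | .o, _, q => q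
  | .arr a b, σ, q => arrow (σ a .zero) (full b (fun α x => σ α (.succ x)) q)

end Atom

namespace HORS

variable {G : HORS.{u}}

/-- Typing environments: a conjunctive mapping of the right type for each symbol. -/
abbrev Env (X : Ty → Type u) : Type u := ∀ τ, X τ → Conj τ

/-- `Judge Θ ρ t θ` is the judgement `Θ, ρ ⊢ t ▷ θ` for an atomic mapping `θ`, in the environment
consisting of `Θ` on the non-terminals and `ρ` on the variables. The premise `t₂ ▷ σ` of the
application rule means that `t₂ ▷ φ` for all atomic mappings `φ` of the conjunction `σ`. -/
inductive Judge (Θ : Env G.nonterminal) {X : Ty → Type} (ρ : Env X) :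
    {τ : Ty} → G.OpenTerm X τ → Atom τ → Prop
  | nonterminal {τ : Ty} (F : G.nonterminal τ) (θ : Atom τ) :
      θ ∈ Θ τ F → Judge Θ ρ (.sym (.nonterminal F)) θ
  | var {τ : Ty} (x : X τ) (θ : Atom τ) : θ ∈ ρ τ x → Judge Θ ρ (.sym (.var x)) θ
  | terminal {τ : Ty} (a : G.terminal τ) (θ : Atom τ) :
      θ.target = .inf → θ.ExistsArg (fun α σ => σ = {Atom.inf α}) →
      Judge Θ ρ (.sym (.terminal a)) θ
  | app {a b : Ty} (t₁ : G.OpenTerm X (.arr a b)) (t₂ : G.OpenTerm X a) (σ : Conj a)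
      (θ : Atom b) :
      Judge Θ ρ t₁ (Atom.arrow σ θ) → (∀ φ ∈ σ, Judge Θ ρ t₂ φ) → Judge Θ ρ (.app t₁ t₂) θ
  | inf_arrow_inf {a b : Ty} (t : G.OpenTerm X (.arr a b)) :
      Judge Θ ρ t (Atom.arrow {Atom.inf a} (Atom.inf b))
  | inf_app {a b : Ty} (t₁ : G.OpenTerm X (.arr a b)) (t₂ : G.OpenTerm X a) :
      Judge Θ ρ t₁ (Atom.inf (.arr a b)) → Judge Θ ρ (.app t₁ t₂) (Atom.inf b)

/-- The judgement `Θ, ρ ⊢ t ▷ σ` for a conjunctive mapping `σ`. -/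
def JudgeConj (Θ : Env G.nonterminal) {X : Ty → Type} (ρ : Env X) {τ : Ty}
    (t : G.OpenTerm X τ) (σ : Conj τ) : Prop :=
  ∀ θ ∈ σ, Judge Θ ρ t θ

/-- The environment without variables. -/
def noVarEnv : Env NoVar := fun _ x => x.elim

/-- If `Θ ⊢ F ▷ σ₁ → ⋯ → σᵢ → q` for a rule `F x₁ ⋯ xₖ → e`, then `q_∞ ∈ σⱼ` for some `j`, or
`i = k` and `Θ, x₁ ▷ σ₁, …, xₖ ▷ σₖ ⊢ e ▷ q`. -/
def IsWitness (Θ : Env G.nonterminal) : Prop :=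
  ∀ (τ : Ty) (F : G.nonterminal τ) (θ : Atom τ),
    Judge Θ noVarEnv (.sym (.nonterminal F)) θ →
      θ.ExistsArg (fun α σ => Atom.inf α ∈ σ) ∨
      ∃ (σ : ∀ α, Param τ α → Conj α) (q : Q),
        θ = Atom.full τ σ q ∧ Judge Θ σ (G.rule F) (Atom.base q)

/-- `⊢ (G, t) ▷ σ`. -/
def Matches {τ : Ty} (t : G.CTerm τ) (σ : Conj τ) : Prop :=
  ∃ Θ : Env G.nonterminal, IsWitness Θ ∧ JudgeConj Θ noVarEnv t σ

/-- `⊢ (G, t) ▷ q` for an atom `q ∈ Q`, identified with `⋀{q}`. -/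
def MatchesAtom {τ : Ty} (t : G.CTerm τ) (q : Q) : Prop :=
  ∃ θ : Atom τ, Atom.ofQ q τ = some θ ∧ Matches t {θ}

end HORS

end RecScheme

/-!
# Soundness and completeness of the type system for `q_∞` and `q_⊥`

Two IO redexes are never nested, so IO reduction has the diamond property (`IOStep.diamond`) and is
confluent. A derivation from a ground term `r` that stops has reached a redex-free term, whose tree
is then the value tree of `r`. Hence `PInf t` says that `t` has no IO normal form (`pInf_iff`), and
`PBot t` that no reduct of the ground term `t` has a terminal at its head (`pBot_iff`).

*Soundness.* Fix a witness `Θ`. Redex-free terms do not have `q_∞` (`IsWitness.not_judge_inf`), and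
so a redex that is contracted by an IO step has no argument with `q_∞`; the condition on witnesses
then types the right-hand side of its rule. This gives subject reduction
(`IsWitness.subject_reduction`). So a term with `q_∞` has no redex-free reduct, and a term with
`q_⊥` no reduct with a terminal at its head, since atomic mappings of the latter end in `q_∞`.

*Completeness.* By recursion on its type, each closed term `t` is given the set `sem t` of the
mappings that it has by virtue of its behaviour: `q_∞` and `q_⊥` as `PInf` and `PBot` tell, and
`argSem u → φ` for every closed `u` and every `φ ∈ sem (t u)`. Here `argSem u` is the complete
description `sem u`, except that it is `{q_∞}` if `u` diverges, which is the form that the rule for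
terminals asks for. These sets are invariant under reduction (`IOSteps.sem_eq`), and everything in
`sem` of an instance of an open term `e` is derivable for `e` if the variables have the `sem` of
the terms substituted for them (`judge_of_mem_sem`). Therefore the environment `F ↦ sem F` is a
witness (`isWitness_semEnv`), and it types every `t` with all of `sem t`.
-/

namespace RecScheme

universe u

/-! ### Redexes and redex-free terms -/

theorem Term.head_applyArgs {Γ : Ty → Type u} : {τ : Ty} → (t : Term Γ τ) →
    (s : ∀ α, Param τ α → Term Γ α) → (t.applyArgs s).head = t.head
  | .o, _, _ => rfl
  | .arr _ _, t, s => Term.head_applyArgs (.app t (s _ .zero)) fun α x => s α (.succ x)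

theorem Term.applyArgs_inj {Γ : Ty → Type u} : {τ : Ty} → (t t' : Term Γ τ) →
    (s s' : ∀ α, Param τ α → Term Γ α) → t.applyArgs s = t'.applyArgs s' → t = t' ∧ s = s'
  | .o, _, _, _, _, h => ⟨h, by funext α x; cases x⟩
  | .arr _ _, t, t', s, s', h => by
    obtain ⟨h1, h2⟩ := Term.applyArgs_inj (.app t (s _ .zero)) (.app t' (s' _ .zero))
      (fun α x => s α (.succ x)) (fun α x => s' α (.succ x)) h
    injection h1 with _ _ h3 h4
    refine ⟨h3, ?_⟩
    funext α x
    cases x with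
    | zero => exact h4
    | succ x => exact congrFun (congrFun h2 α) x

namespace HORS

variable {G : HORS.{u}}

theorem isRedex_applyArgs : {τ : Ty} → (t : G.CTerm τ) → headLabel t.head = .bot →
    (s : ∀ α, Param τ α → G.CTerm α) → IsRedex (t.applyArgs s)
  | _, .sym (.terminal _), h, _ => by cases h
  | _, .sym (.nonterminal F), _, s => ⟨_, F, s, rfl⟩
  | _, .sym (.var x), _, _ => x.elim
  | _, .app (τ₁ := a) (τ₂ := b) t₁ t₂, h, s =>
    isRedex_applyArgs t₁ h fun α (x : Param (.arr a b) α) =>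
      match α, x with
      | _, .zero => t₂
      | α, .succ y => s α y

theorem isRedex_iff {r : G.CTerm .o} : IsRedex r ↔ headLabel r.head = .bot := by
  constructor
  · rintro ⟨τ, F, s, rfl⟩
    rw [Term.head_applyArgs]
    rfl
  · intro h
    exact isRedex_applyArgs r h fun α x => nomatch x

theorem RedexFree.left {a b : Ty} {t₁ : G.CTerm (.arr a b)} {t₂ : G.CTerm a}
    (h : RedexFree (Term.app t₁ t₂)) : RedexFree t₁ :=
  fun r hr hs => h r hr (.left _ hs)

theorem RedexFree.right {a b : Ty} {t₁ : G.CTerm (.arr a b)} {t₂ : G.CTerm a}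
    (h : RedexFree (Term.app t₁ t₂)) : RedexFree t₂ :=
  fun r hr hs => h r hr (.right _ hs)

theorem RedexFree.app {a b : Ty} {t₁ : G.CTerm (.arr a b)} {t₂ : G.CTerm a}
    (h₁ : RedexFree t₁) (h₂ : RedexFree t₂)
    (h : b = .o → headLabel t₁.head ≠ .bot) : RedexFree (Term.app t₁ t₂) := by
  intro r hr hs
  cases hs with
  | refl => exact h rfl (isRedex_iff.1 hr)
  | left _ hs => exact h₁ r hr hs
  | right _ hs => exact h₂ r hr hs

theorem RedexFree.not_isRedex {t : G.CTerm .o} (h : RedexFree t) : ¬ IsRedex t :=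
  fun hr => h t hr (.refl t)

/-- The immediate subterms of `t` are redex-free. -/
def ComponentsRedexFree : {τ : Ty} → G.CTerm τ → Prop
  | _, .sym _ => True
  | _, .app t₁ t₂ => RedexFree t₁ ∧ RedexFree t₂

theorem RedexFree.components {τ : Ty} {t : G.CTerm τ} (h : RedexFree t) :
    ComponentsRedexFree t := by
  cases t with
  | sym _ => trivial
  | app t₁ t₂ => exact ⟨h.left, h.right⟩

theorem ComponentsRedexFree.redexFree {τ : Ty} {t : G.CTerm τ} (h : ComponentsRedexFree t)
    (h' : τ = .o → headLabel t.head ≠ .bot) : RedexFree t := by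
  cases t with
  | sym c =>
    intro r hr hs
    cases hs
    exact h' rfl (isRedex_iff.1 hr)
  | app t₁ t₂ => exact h.1.app h.2 h'

theorem componentsRedexFree_applyArgs : {τ : Ty} → (t : G.CTerm τ) →
    (s : ∀ α, Param τ α → G.CTerm α) →
    (ComponentsRedexFree (t.applyArgs s) ↔ ComponentsRedexFree t ∧ ∀ α x, RedexFree (s α x))
  | .o, t, s => ⟨fun h => ⟨h, fun _ x => nomatch x⟩, fun h => h.1⟩
  | .arr a b, t, s => by
    have ih := componentsRedexFree_applyArgs (.app t (s _ .zero)) fun α x => s α (.succ x)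
    refine ih.trans ⟨fun ⟨⟨h1, h2⟩, h3⟩ => ⟨h1.components, fun α x => ?_⟩,
      fun ⟨h1, h2⟩ => ⟨⟨h1.redexFree (by simp), h2 _ _⟩, fun α x => h2 _ _⟩⟩
    cases x with
    | zero => exact h2
    | succ x => exact h3 _ x

/-! ### IO steps -/

theorem exists_step_of_components {t : G.CTerm .o} (h : ComponentsRedexFree t)
    (hr : IsRedex t) : ∃ t', IOStep t t' := by
  obtain ⟨τ, F, s, rfl⟩ := hr
  exact ⟨_, .redex F s ((componentsRedexFree_applyArgs _ s).1 h).2⟩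

/-- An innermost redex is an IO redex. -/
theorem redexFree_of_no_step : {τ : Ty} → (t : G.CTerm τ) → (∀ t', ¬ IOStep t t') → RedexFree t
  | τ, .sym c, h => by
    refine ComponentsRedexFree.redexFree trivial ?_
    rintro rfl hc
    obtain ⟨t', ht⟩ := exists_step_of_components (t := Term.sym c) trivial (isRedex_iff.2 hc)
    exact h t' ht
  | τ, .app t₁ t₂, h => by
    have h₁ := redexFree_of_no_step t₁ fun t' ht => h _ (.left _ ht)
    have h₂ := redexFree_of_no_step t₂ fun t' ht => h _ (.right _ ht)
    refine h₁.app h₂ ?_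
    rintro rfl hc
    obtain ⟨t', ht⟩ := exists_step_of_components (t := Term.app t₁ t₂) ⟨h₁, h₂⟩ (isRedex_iff.2 hc)
    exact h t' ht

theorem IOStep.not_redexFree {τ : Ty} {t t' : G.CTerm τ} (h : IOStep t t') : ¬ RedexFree t := by
  induction h with
  | redex F s hs => exact fun hf => hf.not_isRedex ⟨_, F, s, rfl⟩
  | left s _ ih => exact fun hf => ih hf.left
  | right t _ ih => exact fun hf => ih hf.right

theorem IOStep.head_eq {τ : Ty} {t t' : G.CTerm τ} (h : IOStep t t')
    (hτ : τ ≠ .o ∨ headLabel t.head ≠ .bot) : t'.head = t.head := by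
  induction h with
  | redex F s hs =>
    rcases hτ with h | h
    · exact (h rfl).elim
    · exact (h (isRedex_iff.1 ⟨_, F, s, rfl⟩)).elim
  | left s _ ih => exact ih (Or.inl (by simp))
  | right t _ ih => rfl

theorem IOStep.app_cases {a b : Ty} {t₁ : G.CTerm (.arr a b)} {t₂ : G.CTerm a} {u : G.CTerm b}
    (h : IOStep (Term.app t₁ t₂) u) :
    (∃ t₁', IOStep t₁ t₁' ∧ u = .app t₁' t₂) ∨ (∃ t₂', IOStep t₂ t₂' ∧ u = .app t₁ t₂') ∨
      (RedexFree t₁ ∧ RedexFree t₂) := by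
  generalize hw : Term.app t₁ t₂ = w at h
  cases h with
  | redex F s hs =>
    have := (componentsRedexFree_applyArgs (Term.sym (.nonterminal F)) s).2 ⟨trivial, hs⟩
    rw [← hw] at this
    exact Or.inr (Or.inr this)
  | left s h => cases hw; exact Or.inl ⟨_, h, rfl⟩
  | right t h => cases hw; exact Or.inr (Or.inl ⟨_, h, rfl⟩)

theorem IOStep.eq_redex {α : Ty} {w u : G.CTerm α} (h : IOStep w u)
    (hc : ComponentsRedexFree w) :
    ∃ (τ : Ty) (F : G.nonterminal τ) (s : ∀ α, Param τ α → G.CTerm α),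
      (⟨α, w, u⟩ : Σ α, G.CTerm α × G.CTerm α) =
        ⟨.o, (Term.sym (.nonterminal F)).applyArgs s, subst s (G.rule F)⟩ := by
  cases h with
  | redex F s hs => exact ⟨_, F, s, rfl⟩
  | left s h => exact (h.not_redexFree hc.1).elim
  | right t h => exact (h.not_redexFree hc.2).elim

/-- A ground term all of whose proper subterms are redex-free can only be contracted at the root,
in a unique way. -/
theorem IOStep.redex_unique {τ : Ty} (F : G.nonterminal τ) (s : ∀ α, Param τ α → G.CTerm α)
    (hs : ∀ α x, RedexFree (s α x)) {u : G.CTerm .o}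
    (h : IOStep ((Term.sym (.nonterminal F)).applyArgs s) u) : u = subst s (G.rule F) := by
  obtain ⟨τ', F', s', hw⟩ := h.eq_redex ((componentsRedexFree_applyArgs _ s).2 ⟨trivial, hs⟩)
  injection hw with _ hw
  obtain ⟨hw, rfl⟩ := Prod.ext_iff.1 hw
  have hh := congrArg Term.head hw
  simp only [Term.head_applyArgs, Term.head] at hh
  cases hh
  cases (Term.applyArgs_inj _ _ _ _ hw).2
  rfl

/-- IO redexes are pairwise disjoint, so two different IO steps commute. -/
theorem IOStep.diamond {τ : Ty} {t t₁ t₂ : G.CTerm τ} (h₁ : IOStep t t₁) (h₂ : IOStep t t₂) :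
    t₁ = t₂ ∨ ∃ t₃, IOStep t₁ t₃ ∧ IOStep t₂ t₃ := by
  induction h₁ with
  | redex F s hs => exact Or.inl (h₂.redex_unique F s hs).symm
  | left s h ih =>
    rcases h₂.app_cases with ⟨t', h', rfl⟩ | ⟨t', h', rfl⟩ | ⟨h', -⟩
    · rcases ih h' with rfl | ⟨v, hv, hv'⟩
      · exact Or.inl rfl
      · exact Or.inr ⟨_, .left _ hv, .left _ hv'⟩
    · exact Or.inr ⟨_, .right _ h', .left _ h⟩
    · exact (h.not_redexFree h').elim
  | right s h ih =>
    rcases h₂.app_cases with ⟨t', h', rfl⟩ | ⟨t', h', rfl⟩ | ⟨-, h'⟩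
    · exact Or.inr ⟨_, .left _ h', .right _ h⟩
    · rcases ih h' with rfl | ⟨v, hv, hv'⟩
      · exact Or.inl rfl
      · exact Or.inr ⟨_, .right _ hv, .right _ hv'⟩
    · exact (h.not_redexFree h').elim

/-- Reduction by any number of IO steps. -/
abbrev IOSteps {τ : Ty} : G.CTerm τ → G.CTerm τ → Prop := Relation.ReflTransGen IOStep

theorem IOSteps.confluent {τ : Ty} {t t₁ t₂ : G.CTerm τ} (h₁ : IOSteps t t₁)
    (h₂ : IOSteps t t₂) : ∃ t₃, IOSteps t₁ t₃ ∧ IOSteps t₂ t₃ := by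
  refine Relation.church_rosser (fun a b c hb hc => ?_) h₁ h₂
  rcases hb.diamond hc with rfl | ⟨d, hd, hd'⟩
  · exact ⟨b, .refl, .refl⟩
  · exact ⟨d, .single hd, .single hd'⟩

theorem IOSteps.eq_of_redexFree {τ : Ty} {t t' : G.CTerm τ} (h : IOSteps t t')
    (hf : RedexFree t) : t' = t := by
  rcases Relation.ReflTransGen.cases_head h with rfl | ⟨_, h, -⟩
  · rfl
  · exact (h.not_redexFree hf).elim

theorem IOSteps.to_redexFree {τ : Ty} {t t' n : G.CTerm τ} (h : IOSteps t t')
    (hn : IOSteps t n) (hf : RedexFree n) : IOSteps t' n := by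
  obtain ⟨v, hv, hv'⟩ := h.confluent hn
  rwa [hv'.eq_of_redexFree hf] at hv

theorem IOSteps.app {a b : Ty} {t₁ t₁' : G.CTerm (.arr a b)} {t₂ t₂' : G.CTerm a}
    (h₁ : IOSteps t₁ t₁') (h₂ : IOSteps t₂ t₂') : IOSteps (Term.app t₁ t₂) (.app t₁' t₂') :=
  (h₁.lift (fun t => Term.app t t₂) fun _ _ => .left t₂).trans
    (h₂.lift (fun t => Term.app t₁' t) fun _ _ => .right t₁')

theorem IOSteps.applyArgs : {τ : Ty} → {t t' : G.CTerm τ} →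
    (s s' : ∀ α, Param τ α → G.CTerm α) → IOSteps t t' → (∀ α x, IOSteps (s α x) (s' α x)) →
    IOSteps (t.applyArgs s) (t'.applyArgs s')
  | .o, _, _, _, _, h, _ => h
  | .arr _ _, _, _, s, s', h, hs =>
    IOSteps.applyArgs (fun α x => s α (.succ x)) (fun α x => s' α (.succ x))
      (h.app (hs _ .zero)) fun α x => hs α (.succ x)

theorem IOSteps.head_eq {τ : Ty} {t t' : G.CTerm τ} (h : IOSteps t t')
    (hτ : τ ≠ .o ∨ headLabel t.head ≠ .bot) : t'.head = t.head := by
  induction h with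
  | refl => rfl
  | tail _ h ih => rw [h.head_eq (by rwa [ih]), ih]

/-! ### Normalizing terms -/

/-- `t` has an IO normal form; the terms without IO steps are the redex-free ones. -/
def Normalizing {τ : Ty} (t : G.CTerm τ) : Prop := ∃ n, IOSteps t n ∧ RedexFree n

theorem IOSteps.normalizing_iff {τ : Ty} {t t' : G.CTerm τ} (h : IOSteps t t') :
    Normalizing t ↔ Normalizing t' :=
  ⟨fun ⟨n, hn, hf⟩ => ⟨n, h.to_redexFree hn hf, hf⟩, fun ⟨n, hn, hf⟩ => ⟨n, h.trans hn, hf⟩⟩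

/-- The head of an application is contracted only after its components have been normalized. -/
theorem Normalizing.components {a b : Ty} {t₁ : G.CTerm (.arr a b)} {t₂ : G.CTerm a}
    (h : Normalizing (Term.app t₁ t₂)) : Normalizing t₁ ∧ Normalizing t₂ := by
  obtain ⟨n, hn, hf⟩ := h
  generalize hw : Term.app t₁ t₂ = w at hn
  induction hn using Relation.ReflTransGen.head_induction_on generalizing t₁ t₂ with
  | refl => subst hw; exact ⟨⟨_, .refl, hf.left⟩, ⟨_, .refl, hf.right⟩⟩
  | head h _ ih =>
    subst hw
    rcases h.app_cases with ⟨t', h', rfl⟩ | ⟨t', h', rfl⟩ | ⟨h₁, h₂⟩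
    · obtain ⟨i₁, i₂⟩ := ih rfl
      exact ⟨(IOSteps.normalizing_iff (.single h')).2 i₁, i₂⟩
    · obtain ⟨i₁, i₂⟩ := ih rfl
      exact ⟨i₁, (IOSteps.normalizing_iff (.single h')).2 i₂⟩
    · exact ⟨⟨_, .refl, h₁⟩, ⟨_, .refl, h₂⟩⟩

theorem Normalizing.of_subterm {α τ : Ty} {r : G.CTerm α} {t : G.CTerm τ} (hs : r.Subterm t)
    (h : Normalizing t) : Normalizing r := by
  induction hs with
  | refl => exact h
  | left _ _ ih => exact ih h.components.1
  | right _ _ ih => exact ih h.components.2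

theorem Normalizing.app {a b : Ty} {t₁ : G.CTerm (.arr a b)} {t₂ : G.CTerm a}
    (h₁ : Normalizing t₁) (h₂ : Normalizing t₂) (h : b = .o → headLabel t₁.head ≠ .bot) :
    Normalizing (Term.app t₁ t₂) := by
  obtain ⟨n₁, hn₁, hf₁⟩ := h₁
  obtain ⟨n₂, hn₂, hf₂⟩ := h₂
  refine ⟨_, hn₁.app hn₂, hf₁.app hf₂ ?_⟩
  rwa [hn₁.head_eq (Or.inl (by simp))]

/-- The head of a term of arrow type is never contracted, so normalizing its components normalizes a
term that is not itself a redex. -/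
theorem normalizing_of_redexes {τ : Ty} (t : G.CTerm τ)
    (h : ∀ r : G.CTerm .o, IsRedex r → r.Subterm t → Normalizing r) : Normalizing t := by
  induction t with
  | @sym τ c =>
    by_cases hc : τ = .o ∧ headLabel (⟨_, c⟩ : Σ α, _) = .bot
    · obtain ⟨rfl, hc⟩ := hc
      exact h _ (isRedex_iff.2 hc) (.refl _)
    · exact ⟨_, .refl, ComponentsRedexFree.redexFree trivial fun h1 h2 => hc ⟨h1, h2⟩⟩
  | @app a b t₁ t₂ ih₁ ih₂ =>
    by_cases hc : b = .o ∧ headLabel t₁.head = .bot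
    · obtain ⟨rfl, hc⟩ := hc
      exact h _ (isRedex_iff.2 hc) (.refl _)
    · exact (ih₁ fun r hr hs => h r hr (.left _ hs)).app (ih₂ fun r hr hs => h r hr (.right _ hs))
        fun h1 h2 => hc ⟨h1, h2⟩

theorem normalizing_sym_arr {a b : Ty} (c : Symbol G.terminal G.nonterminal NoVar (.arr a b)) :
    Normalizing (G := G) (Term.sym c) :=
  ⟨_, .refl, ComponentsRedexFree.redexFree trivial (by simp)⟩

/-! ### Trees of reducts -/

/-- Unless a step is taken inside a ground term with a non-terminal head, it acts within one of the
arguments. -/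
theorem IOStep.args_rel {τ : Ty} {t t' : G.CTerm τ} (h : IOStep t t')
    (hτ : τ ≠ .o ∨ headLabel t.head ≠ .bot) :
    List.Forall₂ (fun p p' : Σ α, G.CTerm α =>
      p = p' ∨ ∃ (α : Ty) (v v' : G.CTerm α), p = ⟨α, v⟩ ∧ p' = ⟨α, v'⟩ ∧ IOStep v v')
      t.args t'.args := by
  have hrefl : ∀ l : List (Σ α, G.CTerm α), List.Forall₂ (fun p p' : Σ α, G.CTerm α =>
      p = p' ∨ ∃ (α : Ty) (v v' : G.CTerm α), p = ⟨α, v⟩ ∧ p' = ⟨α, v'⟩ ∧ IOStep v v') l l :=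
    fun l => List.forall₂_same.2 fun p _ => Or.inl rfl
  induction h with
  | redex F s hs =>
    rcases hτ with h | h
    · exact (h rfl).elim
    · exact (h (isRedex_iff.1 ⟨_, F, s, rfl⟩)).elim
  | left s _ ih => exact List.rel_append (ih (Or.inl (by simp))) (hrefl [_])
  | right t h ih => exact List.rel_append (hrefl _) (.cons (Or.inr ⟨_, _, _, rfl, rfl, h⟩) .nil)

theorem IOStep.botLabel_le (u : List ℕ) : ∀ {τ : Ty} {t t' : G.CTerm τ}, IOStep t t' →
    ∀ l, botLabel u ⟨τ, t⟩ = some l →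
      ∃ l', botLabel u ⟨τ, t'⟩ = some l' ∧ (l = .bot ∨ l = l') := by
  induction u with
  | nil =>
    intro τ t t' h l hl
    simp only [botLabel, Option.some.injEq] at hl
    subst hl
    refine ⟨_, rfl, ?_⟩
    by_cases hb : headLabel t.head = .bot
    · exact Or.inl hb
    · exact Or.inr (by rw [h.head_eq (Or.inr hb)])
  | cons j u ih =>
    intro τ t t' h l hl
    simp only [botLabel] at hl ⊢
    cases hb : headLabel t.head with
    | bot => simp [hb] at hl
    | sym a =>
      have hb' : headLabel t.head ≠ .bot := by simp [hb]
      rw [h.head_eq (Or.inr hb'), hb]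
      simp only [hb] at hl
      obtain ⟨p, hp, hl⟩ := Option.bind_eq_some_iff.1 hl
      have hrel := h.args_rel (Or.inr hb')
      obtain ⟨hj, rfl⟩ := List.getElem?_eq_some_iff.1 hp
      have hj' : j < t'.args.length := hrel.length_eq ▸ hj
      have := List.Forall₂.get hrel hj hj'
      simp only [List.get_eq_getElem] at this
      simp only [List.getElem?_eq_getElem hj', Option.bind_some]
      rcases this with h | ⟨α, v, v', h₁, h₂, hv⟩
      · rw [← h]
        exact ⟨l, hl, Or.inr rfl⟩
      · rw [h₂]
        rw [h₁] at hl
        exact ih hv l hl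

theorem IOSteps.botTree_le {t t' : G.CTerm .o} (h : IOSteps t t') : botTree t ≤ botTree t' := by
  induction h with
  | refl => exact le_refl _
  | tail _ h ih => exact ih.trans fun u l hl => h.botLabel_le u l hl

theorem botTree_le_bot_iff {t : G.CTerm .o} : botTree t ≤ ⊥ ↔ headLabel t.head = .bot := by
  constructor
  · intro h
    obtain ⟨l', h', hl⟩ := h [] (headLabel t.head) rfl
    cases h'
    exact hl.elim id id
  · intro h u l hl
    cases u with
    | nil =>
      cases hl
      exact ⟨_, rfl, Or.inl h⟩
    | cons j u =>
      change botLabel _ _ = _ at hl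
      simp [botLabel, h] at hl

theorem bot_le_tree (T : Tree G) : ⊥ ≤ T := by
  intro u l hl
  cases u with
  | nil =>
    cases hl
    exact ⟨_, (Option.some_get T.root).symm, Or.inl rfl⟩
  | cons j u => cases hl

theorem isIOValueTree_bot_iff {t : G.CTerm .o} :
    IsIOValueTree t ⊥ ↔ ∀ s, IOSteps t s → headLabel s.head = .bot := by
  constructor
  · intro h s hs
    exact botTree_le_bot_iff.1 (h.1 ⟨s, hs, rfl⟩)
  · intro h
    refine ⟨?_, fun T _ => bot_le_tree T⟩
    rintro T ⟨s, hs, rfl⟩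
    exact botTree_le_bot_iff.2 (h s hs)

/-! ### Finite derivations -/

theorem IODerivation.reachable {r : G.CTerm .o} (d : IODerivation r) :
    ∀ n t, d.seq n = some t → IOSteps r t
  | 0, t, h => by
    rw [d.seq_zero] at h
    cases h
    exact .refl
  | n + 1, t, h => by
    obtain ⟨t', h', hs⟩ := d.step n t h
    exact (d.reachable n t' h').tail hs

theorem exists_derivation {r n : G.CTerm .o} (h : IOSteps r n) :
    ∃ (d : IODerivation r) (m : ℕ), d.seq m = some n ∧ ∀ k > m, d.seq k = none := by
  induction h with
  | refl =>
    refine ⟨⟨fun k => if k = 0 then some r else none, rfl, ?_⟩, 0, rfl, fun k hk => ?_⟩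
    · intro k t h
      simp at h
    · simp [Nat.pos_iff_ne_zero.1 hk]
  | @tail b c _ hs ih =>
    obtain ⟨d, m, hm, hd⟩ := ih
    refine ⟨⟨fun k => if k = m + 1 then some c else d.seq k, ?_, ?_⟩, m + 1, by simp,
      fun k hk => ?_⟩
    · simpa using d.seq_zero
    · intro k t h
      by_cases hk : k = m
      · subst hk
        simp only [if_true, Option.some.injEq] at h
        subst h
        exact ⟨b, by simpa using hm, hs⟩
      · have hk' : ¬ k + 1 = m + 1 := by omega
        rw [if_neg hk'] at h
        obtain ⟨t', h', hs'⟩ := d.step k t h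
        refine ⟨t', ?_, hs'⟩
        by_cases hk2 : k = m + 1
        · rw [hd k (by omega)] at h'
          cases h'
        · rwa [if_neg hk2]
    · exact (if_neg (by omega)).trans (hd k (by omega))

/-- By confluence the IO normal form, if there is one, is the value tree. -/
theorem isIOValueTree_of_redexFree {r n : G.CTerm .o} (h : IOSteps r n) (hf : RedexFree n) :
    IsIOValueTree r (botTree n) := by
  refine ⟨?_, fun T hT => hT ⟨n, h, rfl⟩⟩
  rintro T ⟨s, hs, rfl⟩
  exact (IOSteps.to_redexFree hs h hf).botTree_le

/-- A finite complete derivation ends in a normal form, and every derivation that ends in a normal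
form produces the value tree. -/
theorem forall_infinite_iff {r : G.CTerm .o} :
    (∀ d : IODerivation r, d.Maximal → d.ProducesValueTree → d.Infinite) ↔ ¬ Normalizing r := by
  constructor
  · rintro h ⟨n, hn, hf⟩
    obtain ⟨d, m, hm, hd⟩ := exists_derivation hn
    have hinf := h d ?_ ⟨botTree n, isIOValueTree_of_redexFree hn hf, ?_, ?_⟩ (m + 1)
    · rw [hd (m + 1) (by omega)] at hinf
      cases hinf
    · intro k t hk hk' t' ht
      -- the derivation stops at `n` only: a defined entry at `m` makes all earlier ones defined
      have hle : ∀ j i, d.seq (i + j) ≠ none → d.seq i ≠ none := by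
        intro j
        induction j with
        | zero => exact fun i hi => hi
        | succ j ih =>
          intro i hi
          obtain ⟨t, ht⟩ := Option.ne_none_iff_exists'.1 hi
          obtain ⟨t', ht', -⟩ := d.step (i + j) t ht
          exact ih i (by simp [ht'])
      have hkm : k = m := by
        by_contra hne
        rcases Nat.lt_or_gt_of_ne hne with hlt | hgt
        · refine hle (m - (k + 1)) (k + 1) ?_ hk'
          rw [Nat.add_sub_cancel' hlt, hm]
          simp
        · rw [hd k hgt] at hk
          cases hk
      subst hkm
      rw [hm] at hk
      cases hk
      exact ht.not_redexFree hf
    · rintro T ⟨k, t, hk, rfl⟩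
      exact ((d.reachable k t hk).to_redexFree hn hf).botTree_le
    · exact fun T hT => hT ⟨m, n, hm, rfl⟩
  · intro h d hmax _ m
    induction m with
    | zero => simp [d.seq_zero]
    | succ m ih =>
      obtain ⟨t, ht⟩ := Option.isSome_iff_exists.1 ih
      by_contra hm
      exact h ⟨t, d.reachable m t ht,
        redexFree_of_no_step t (hmax m t ht (by simpa using hm))⟩

theorem pInf_iff {τ : Ty} (t : G.CTerm τ) : PInf t ↔ ¬ Normalizing t := by
  simp only [PInf, forall_infinite_iff]
  constructor
  · rintro ⟨r, -, hs, hr⟩ h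
    exact hr (h.of_subterm hs)
  · intro h
    by_contra hc
    push Not at hc
    exact h (normalizing_of_redexes t hc)

theorem pBot_iff (t : G.CTerm .o) : PBot t ↔ ∀ s, IOSteps t s → headLabel s.head = .bot :=
  isIOValueTree_bot_iff

end HORS

/-! ### Atomic mappings -/

theorem Atom.full_inj : {τ : Ty} → {σ σ' : ∀ α, Param τ α → Conj α} → {q q' : Q} →
    Atom.full τ σ q = Atom.full τ σ' q' → σ = σ' ∧ q = q'
  | .o, _, _, _, _, h => ⟨(by funext α x; cases x), h⟩
  | .arr a b, σ, σ', q, q', h => by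
    obtain ⟨h1, h2⟩ := Prod.ext_iff.1 (Option.some.inj h)
    obtain ⟨h3, rfl⟩ := Atom.full_inj (τ := b) (σ := fun α x => σ α (.succ x))
      (σ' := fun α x => σ' α (.succ x)) h2
    refine ⟨?_, rfl⟩
    funext α x
    cases x with
    | zero => exact h1
    | succ x => exact congrFun (congrFun h3 α) x

theorem Atom.existsArg_full_iff {P : ∀ α, Conj α → Prop} : {τ : Ty} →
    {σ : ∀ α, Param τ α → Conj α} → {q : Q} →
    ((Atom.full τ σ q).ExistsArg P ↔ ∃ α x, P α (σ α x))
  | .o, _, _ => ⟨False.elim, fun ⟨_, x, _⟩ => nomatch x⟩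
  | .arr a b, σ, q => by
    refine (or_congr_right (Atom.existsArg_full_iff (τ := b))).trans ⟨?_, ?_⟩
    · rintro (h | ⟨α, x, h⟩)
      · exact ⟨_, _, h⟩
      · exact ⟨α, .succ x, h⟩
    · rintro ⟨α, x, h⟩
      cases x with
      | zero => exact Or.inl h
      | succ x => exact Or.inr ⟨α, x, h⟩

theorem Atom.ExistsArg.mono {P P' : ∀ α, Conj α → Prop} (h : ∀ α σ, P α σ → P' α σ) :
    {τ : Ty} → {θ : Atom τ} → θ.ExistsArg P → θ.ExistsArg P'
  | .o, _, hθ => hθ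
  | .arr _ _, none, hθ => hθ
  | .arr _ _, some _, hθ => hθ.imp (h _ _) (Atom.ExistsArg.mono h)

theorem Atom.not_existsArg_inf {P : ∀ α, Conj α → Prop} : (τ : Ty) → ¬ (Atom.inf τ).ExistsArg P
  | .o => id
  | .arr _ _ => id

theorem Atom.full_arr_ne_inf {a b : Ty} (σ : ∀ α, Param (.arr a b) α → Conj α) (q : Q) :
    Atom.full (.arr a b) σ q ≠ Atom.inf (.arr a b) :=
  fun h => nomatch h

theorem Atom.target_inf : (τ : Ty) → (Atom.inf τ).target = .inf
  | .o => rfl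
  | .arr _ _ => rfl

namespace HORS

variable {G : HORS.{u}} {Θ : Env G.nonterminal}

/-! ### Soundness -/

theorem Judge.subst {X Y : Ty → Type} {ρ : Env X} {ρ' : Env Y} {τ : Ty}
    {e : G.OpenTerm X τ} {θ : Atom τ} (h : Judge Θ ρ e θ) (s : ∀ α, X α → G.OpenTerm Y α)
    (hs : ∀ α x, JudgeConj Θ ρ' (s α x) (ρ α x)) : Judge Θ ρ' (HORS.subst s e) θ := by
  induction h with
  | nonterminal F θ h => exact .nonterminal F θ h
  | var x θ h => exact hs _ x θ h
  | terminal a θ h h' => exact .terminal a θ h h'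
  | app t₁ t₂ σ θ _ _ ih₁ ih₂ => exact .app _ _ σ θ ih₁ ih₂
  | inf_arrow_inf t => exact .inf_arrow_inf _
  | inf_app t₁ t₂ _ ih => exact .inf_app _ _ ih

/-- Every atomic mapping of `t` either requires some argument to have `q_∞` or takes all arguments
into account. This is what a witness guarantees for the non-terminals. -/
def InfOrFull (Θ : Env G.nonterminal) {τ : Ty} (t : G.CTerm τ) : Prop :=
  ∀ θ, Judge Θ noVarEnv t θ →
    θ.ExistsArg (fun α σ => Atom.inf α ∈ σ) ∨ ∃ σ q, θ = Atom.full τ σ q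

/-- Every atomic mapping of `t` requires some argument to have `q_∞`. -/
def InfArg (Θ : Env G.nonterminal) {τ : Ty} (t : G.CTerm τ) : Prop :=
  ∀ θ, Judge Θ noVarEnv t θ → θ.ExistsArg (fun α σ => Atom.inf α ∈ σ)

theorem InfOrFull.not_inf {a b : Ty} {t : G.CTerm (.arr a b)} (h : InfOrFull Θ t) :
    ¬ Judge Θ noVarEnv t (Atom.inf _) := by
  intro ht
  rcases h _ ht with h | ⟨σ, q, h⟩
  · exact Atom.not_existsArg_inf _ h
  · exact Atom.full_arr_ne_inf σ q h.symm

theorem InfArg.not_inf {τ : Ty} {t : G.CTerm τ} (h : InfArg Θ t) :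
    ¬ Judge Θ noVarEnv t (Atom.inf _) :=
  fun ht => Atom.not_existsArg_inf _ (h _ ht)

theorem InfOrFull.app {a b : Ty} {t₁ : G.CTerm (.arr a b)} {t₂ : G.CTerm a}
    (h : InfOrFull Θ t₁) (h₂ : ¬ Judge Θ noVarEnv t₂ (Atom.inf _)) :
    InfOrFull Θ (Term.app t₁ t₂) := by
  intro θ hθ
  cases hθ with
  | app _ _ σ _ h₁ hσ =>
    rcases h _ h₁ with (h | h) | ⟨σ', q, h⟩
    · exact (h₂ (hσ _ h)).elim
    · exact Or.inl h
    · exact Or.inr ⟨fun α x => σ' α (.succ x), q, (Prod.ext_iff.1 (Option.some.inj h)).2⟩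
  | inf_arrow_inf => exact Or.inl (Or.inl rfl)
  | inf_app _ _ h₁ => exact (h.not_inf h₁).elim

theorem InfArg.app {a b : Ty} {t₁ : G.CTerm (.arr a b)} {t₂ : G.CTerm a}
    (h : InfArg Θ t₁) (h₂ : ¬ Judge Θ noVarEnv t₂ (Atom.inf _)) : InfArg Θ (Term.app t₁ t₂) := by
  intro θ hθ
  cases hθ with
  | app _ _ σ _ h₁ hσ =>
    rcases h _ h₁ with h | h
    · exact (h₂ (hσ _ h)).elim
    · exact h
  | inf_arrow_inf => exact Or.inl rfl
  | inf_app _ _ h₁ => exact (h.not_inf h₁).elim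

theorem IsWitness.infOrFull (hΘ : IsWitness Θ) {τ : Ty} (F : G.nonterminal τ) :
    InfOrFull Θ (Term.sym (.nonterminal F)) := by
  intro θ h
  rcases hΘ τ F θ h with h | ⟨σ, q, h, -⟩
  · exact Or.inl h
  · exact Or.inr ⟨σ, q, h⟩

theorem infArg_terminal {τ : Ty} (a : G.terminal τ) : InfArg Θ (Term.sym (.terminal a)) := by
  intro θ h
  cases h with
  | terminal _ _ _ h => exact Atom.ExistsArg.mono (fun α σ hσ => by simp [hσ]) h
  | inf_arrow_inf => exact Or.inl rfl

/-- The induction behind `IsWitness.not_judge_inf`. A ground redex-free term has a terminal as its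
head, and there `InfOrFull` would say nothing: hence the stronger invariant for such terms. -/
theorem IsWitness.redexFree_cases (hΘ : IsWitness Θ) : {τ : Ty} → (t : G.CTerm τ) → RedexFree t →
    (headLabel t.head = .bot → InfOrFull Θ t) ∧ (headLabel t.head ≠ .bot → InfArg Θ t) ∧
      ¬ Judge Θ noVarEnv t (Atom.inf _)
  | τ, .sym (.terminal a), _ =>
    ⟨fun h => (nomatch h), fun _ => infArg_terminal a, (infArg_terminal a).not_inf⟩
  | .arr _ _, .sym (.nonterminal F), _ =>
    ⟨fun _ => hΘ.infOrFull F, fun h => (h rfl).elim, (hΘ.infOrFull F).not_inf⟩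
  | .o, .sym (.nonterminal F), h => (h.not_isRedex (isRedex_iff.2 rfl)).elim
  | _, .sym (.var x), _ => x.elim
  | b, .app t₁ t₂, h => by
    obtain ⟨h₁, h₁', -⟩ := hΘ.redexFree_cases t₁ h.left
    have h₂ := (hΘ.redexFree_cases t₂ h.right).2.2
    refine ⟨fun hb => (h₁ hb).app h₂, fun hb => (h₁' hb).app h₂, ?_⟩
    by_cases hb : headLabel t₁.head = .bot
    · cases b with
      | o => exact (h.not_isRedex (isRedex_iff.2 hb)).elim
      | arr _ _ => exact ((h₁ hb).app h₂).not_inf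
    · exact ((h₁' hb).app h₂).not_inf

theorem IsWitness.not_judge_inf (hΘ : IsWitness Θ) {τ : Ty} {t : G.CTerm τ} (h : RedexFree t) :
    ¬ Judge Θ noVarEnv t (Atom.inf _) :=
  (hΘ.redexFree_cases t h).2.2

/-- Inversion of the typing of an application to all arguments, none of which has `q_∞`. -/
theorem InfOrFull.judge_applyArgs : {τ : Ty} → {t : G.CTerm τ} → InfOrFull Θ t →
    {s : ∀ α, Param τ α → G.CTerm α} → (∀ α x, ¬ Judge Θ noVarEnv (s α x) (Atom.inf _)) →
    {q : Q} → Judge Θ noVarEnv (t.applyArgs s) (Atom.base q) →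
    ∃ σ, Judge Θ noVarEnv t (Atom.full τ σ q) ∧ ∀ α x, JudgeConj Θ noVarEnv (s α x) (σ α x)
  | .o, t, _, s, _, q, h => ⟨fun _ x => (nomatch x), h, fun _ x => (nomatch x)⟩
  | .arr a b, t, ht, s, hs, q, h => by
    obtain ⟨σ, h₁, h₂⟩ := (ht.app (hs _ .zero)).judge_applyArgs
      (s := fun α x => s α (.succ x)) (fun α x => hs _ _) h
    generalize hθ : Atom.full b σ q = θ at h₁
    cases h₁ with
    | app _ _ σ₀ _ h h₀ =>
      subst hθ
      refine ⟨fun α (x : Param (.arr a b) α) => (match α, x with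
        | _, .zero => σ₀
        | α, .succ y => σ α y), h, fun α x => ?_⟩
      cases x with
      | zero => exact h₀
      | succ x => exact h₂ _ x
    | inf_arrow_inf =>
      have hz : σ _ .zero = {Atom.inf _} := (Prod.ext_iff.1 (Option.some.inj hθ)).1
      exact (hs _ (.succ .zero) (h₂ _ .zero _ (by rw [hz]; rfl))).elim
    | inf_app _ _ h => exact (ht.not_inf h).elim

/-- Innermost reduction matters here: the arguments of the contracted redex are redex-free and hence do
not have `q_∞`, which leaves only the second alternative in the definition of a witness. -/
theorem IsWitness.subject_reduction (hΘ : IsWitness Θ) {τ : Ty} {t t' : G.CTerm τ}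
    (h : IOStep t t') : ∀ θ, Judge Θ noVarEnv t θ → Judge Θ noVarEnv t' θ := by
  induction h with
  | redex F s hs =>
    intro q hq
    have hs' := fun α x => hΘ.not_judge_inf (hs α x)
    obtain ⟨σ, h₁, h₂⟩ := (hΘ.infOrFull F).judge_applyArgs hs' (q := q) hq
    rcases hΘ _ F _ h₁ with h | ⟨σ', q', h, h₃⟩
    · obtain ⟨α, x, hx⟩ := Atom.existsArg_full_iff.1 h
      exact (hs' α x (h₂ α x _ hx)).elim
    · obtain ⟨rfl, rfl⟩ := Atom.full_inj h
      exact h₃.subst s h₂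
  | left s _ ih =>
    intro θ hθ
    cases hθ with
    | app _ _ σ _ h₁ hσ => exact .app _ _ σ θ (ih _ h₁) hσ
    | inf_arrow_inf => exact .inf_arrow_inf _
    | inf_app _ _ h₁ => exact .inf_app _ _ (ih _ h₁)
  | right t _ ih =>
    intro θ hθ
    cases hθ with
    | app _ _ σ _ h₁ hσ => exact .app _ _ σ θ h₁ fun φ hφ => ih _ (hσ φ hφ)
    | inf_arrow_inf => exact .inf_arrow_inf _
    | inf_app _ _ h₁ => exact .inf_app _ _ h₁

theorem IsWitness.subject_reduction_steps (hΘ : IsWitness Θ) {τ : Ty} {t t' : G.CTerm τ}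
    (h : IOSteps t t') {θ : Atom τ} (hθ : Judge Θ noVarEnv t θ) : Judge Θ noVarEnv t' θ := by
  induction h with
  | refl => exact hθ
  | tail _ h ih => exact hΘ.subject_reduction h _ ih

theorem judge_target_of_terminal_head {τ : Ty} (t : G.CTerm τ) (h : headLabel t.head ≠ .bot) :
    ∀ θ, Judge Θ noVarEnv t θ → θ.target = .inf := by
  induction t with
  | sym c =>
    intro θ hθ
    cases hθ with
    | nonterminal F _ _ => exact (h rfl).elim
    | var x => exact x.elim
    | terminal _ _ h _ => exact h
    | inf_arrow_inf => exact Atom.target_inf _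
  | app t₁ t₂ ih _ =>
    intro θ hθ
    cases hθ with
    | app _ _ σ _ h₁ _ => exact ih h _ h₁
    | inf_arrow_inf => exact Atom.target_inf _
    | inf_app _ _ _ => exact Atom.target_inf _

theorem IsWitness.pInf_of_judge (hΘ : IsWitness Θ) {τ : Ty} {t : G.CTerm τ}
    (h : Judge Θ noVarEnv t (Atom.inf τ)) : PInf t := by
  rw [pInf_iff]
  rintro ⟨n, hn, hf⟩
  exact hΘ.not_judge_inf hf (hΘ.subject_reduction_steps hn h)

theorem IsWitness.pBot_of_judge (hΘ : IsWitness Θ) {t : G.CTerm .o}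
    (h : Judge Θ noVarEnv t (Atom.base .bot)) : PBot t := by
  rw [pBot_iff]
  intro s hs
  by_contra hb
  cases judge_target_of_terminal_head s hb _ (hΘ.subject_reduction_steps hs h)

/-! ### Completeness -/

open Classical in
/-- The atomic mappings that a closed term has by virtue of its behaviour. At an arrow type the
argument mappings `σ` of `σ → θ` range over those actually realized by a closed argument `u`; if `u`
contains a diverging redex, it is recorded by `{q_∞}` alone, as the typing rules for terminals
demand. -/
def sem : {τ : Ty} → G.CTerm τ → Conj τ
  | .o, t => {q | (q = Q.inf ∧ PInf t) ∨ (q = Q.bot ∧ PBot t)}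
  | .arr a b, t =>
    {θ | (θ = Atom.inf (.arr a b) ∧ PInf t) ∨
      ∃ (u : G.CTerm a) (φ : Atom b), φ ∈ sem (Term.app t u) ∧
        θ = Atom.arrow (if PInf u then {Atom.inf a} else sem u) φ}

open Classical in
/-- The conjunctive mapping that describes a closed term in argument position. -/
def argSem {τ : Ty} (u : G.CTerm τ) : Conj τ := if PInf u then {Atom.inf τ} else sem u

theorem mem_sem_arr {a b : Ty} {t : G.CTerm (.arr a b)} {θ : Atom (.arr a b)} :
    θ ∈ sem t ↔ (θ = Atom.inf (.arr a b) ∧ PInf t) ∨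
      ∃ (u : G.CTerm a) (φ : Atom b), φ ∈ sem (Term.app t u) ∧ θ = Atom.arrow (argSem u) φ := by
  rw [sem]
  rfl

theorem mem_sem_o {t : G.CTerm .o} {q : Q} :
    Atom.base q ∈ sem t ↔ (q = .inf ∧ PInf t) ∨ (q = .bot ∧ PBot t) := by
  rw [sem]
  rfl

theorem inf_mem_sem {τ : Ty} {t : G.CTerm τ} : Atom.inf τ ∈ sem t ↔ PInf t := by
  cases τ with
  | o => exact mem_sem_o.trans ⟨fun h => h.elim And.right fun h => (nomatch h.1),
      fun h => Or.inl ⟨rfl, h⟩⟩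
  | arr a b => exact mem_sem_arr.trans ⟨fun h => h.elim And.right fun ⟨_, _, _, h⟩ => (nomatch h),
      fun h => Or.inl ⟨rfl, h⟩⟩

theorem argSem_of_pInf {τ : Ty} {u : G.CTerm τ} (h : PInf u) : argSem u = {Atom.inf τ} :=
  if_pos h

theorem argSem_of_not_pInf {τ : Ty} {u : G.CTerm τ} (h : ¬ PInf u) : argSem u = sem u :=
  if_neg h

theorem argSem_subset {τ : Ty} (u : G.CTerm τ) : argSem u ⊆ sem u := by
  by_cases h : PInf u
  · rw [argSem_of_pInf h, Set.singleton_subset_iff]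
    exact inf_mem_sem.2 h
  · rw [argSem_of_not_pInf h]

theorem IOSteps.pInf_iff {τ : Ty} {t t' : G.CTerm τ} (h : IOSteps t t') : PInf t ↔ PInf t' := by
  rw [HORS.pInf_iff, HORS.pInf_iff, h.normalizing_iff]

theorem IOSteps.pBot_iff {t t' : G.CTerm .o} (h : IOSteps t t') : PBot t ↔ PBot t' := by
  rw [HORS.pBot_iff, HORS.pBot_iff]
  refine ⟨fun ht s hs => ht s (h.trans hs), fun ht s hs => ?_⟩
  by_contra hb
  obtain ⟨v, hv, hv'⟩ := IOSteps.confluent h hs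
  exact hb (by rw [← IOSteps.head_eq hv' (Or.inr hb)]; exact ht v hv)

theorem IOSteps.sem_eq : {τ : Ty} → {t t' : G.CTerm τ} → IOSteps t t' → sem t = sem t'
  | .o, t, t', h => by
    ext q
    exact mem_sem_o.trans ((by rw [h.pInf_iff, h.pBot_iff]) : _ ↔ _) |>.trans mem_sem_o.symm
  | .arr a b, t, t', h => by
    ext θ
    rw [mem_sem_arr, mem_sem_arr, h.pInf_iff]
    simp only [fun u : G.CTerm a => IOSteps.sem_eq (h.app (.refl (a := u)))]

/-- An element `σ₁ → ⋯ → σᵢ → q` of `sem t` comes from actual arguments `u₁, …, uᵢ`. If `t` and they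
are normalizing, then so is `t u₁ ⋯ uᵢ` unless it is ground, so that `i` is the full arity. -/
theorem mem_sem_cases {P : ∀ α, Conj α → Prop}
    (hP : ∀ α (u : G.CTerm α), PInf u → P α (argSem u)) : {τ : Ty} → {t : G.CTerm τ} →
    {θ : Atom τ} → θ ∈ sem t → Normalizing t ∨ τ = .o → θ.ExistsArg P ∨
      ∃ (s : ∀ α, Param τ α → G.CTerm α) (q : Q),
        θ = Atom.full τ (fun α x => argSem (s α x)) q ∧ Atom.base q ∈ sem (t.applyArgs s)
  | .o, t, q, h, _ => Or.inr ⟨fun _ x => (nomatch x), q, rfl, h⟩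
  | .arr a b, t, θ, h, hn => by
    replace hn : Normalizing t := hn.resolve_right (by simp)
    rcases mem_sem_arr.1 h with ⟨-, h⟩ | ⟨u, φ, hφ, rfl⟩
    · exact ((pInf_iff t).1 h hn).elim
    by_cases hu : PInf u
    · exact Or.inl (Or.inl (hP _ u hu))
    have hu' : Normalizing u := not_not.1 fun h => hu ((pInf_iff u).2 h)
    have hb : Normalizing (Term.app t u) ∨ b = .o := by
      by_cases hb : b = .o
      · exact Or.inr hb
      · exact Or.inl (hn.app hu' fun h => (hb h).elim)
    rcases mem_sem_cases hP hφ hb with h | ⟨s, q, rfl, hq⟩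
    · exact Or.inl (Or.inr h)
    · refine Or.inr ⟨fun α (x : Param (.arr a b) α) => (match α, x with
        | _, .zero => u
        | α, .succ y => s α y), q, rfl, hq⟩

/-- A terminal-headed term diverges only if an argument does, and it never has the value `⊥`. -/
theorem mem_sem_terminal {P : ∀ α, Conj α → Prop}
    (hP : ∀ α (u : G.CTerm α), PInf u → P α (argSem u)) : {τ : Ty} → {t : G.CTerm τ} →
    headLabel t.head ≠ .bot → Normalizing t → ∀ {θ}, θ ∈ sem t →
    θ.ExistsArg P
  | .o, t, hb, hn, q, h => by
    rcases mem_sem_o.1 h with ⟨-, h⟩ | ⟨-, h⟩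
    · exact ((pInf_iff t).1 h hn).elim
    · exact (hb ((pBot_iff t).1 h t .refl)).elim
  | .arr a b, t, hb, hn, θ, h => by
    rcases mem_sem_arr.1 h with ⟨-, h⟩ | ⟨u, φ, hφ, rfl⟩
    · exact ((pInf_iff t).1 h hn).elim
    by_cases hu : PInf u
    · exact Or.inl (hP _ u hu)
    have hu' : Normalizing u := not_not.1 fun h => hu ((pInf_iff u).2 h)
    exact Or.inr (mem_sem_terminal hP (t := Term.app t u) hb (hn.app hu' fun _ => hb) hφ)

theorem target_of_mem_sem_terminal : {τ : Ty} → {t : G.CTerm τ} →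
    headLabel t.head ≠ .bot → ∀ {θ}, θ ∈ sem t → θ.target = .inf
  | .o, t, hb, q, h => by
    rcases mem_sem_o.1 h with ⟨h, -⟩ | ⟨-, h⟩
    · exact h
    · exact (hb ((pBot_iff t).1 h t .refl)).elim
  | .arr a b, t, hb, θ, h => by
    rcases mem_sem_arr.1 h with ⟨rfl, -⟩ | ⟨u, φ, hφ, rfl⟩
    · rfl
    · exact target_of_mem_sem_terminal (t := Term.app t u) hb hφ

/-- The semantic environment on the non-terminals. -/
def semEnv (G : HORS.{u}) : Env G.nonterminal := fun _ F => sem (Term.sym (.nonterminal F))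

/-- Subject expansion: what holds of an instance of `e` is derivable for `e`, from what holds of the
terms substituted. -/
theorem judge_of_mem_sem {X : Ty → Type} (s : ∀ α, X α → G.CTerm α) {τ : Ty}
    (e : G.OpenTerm X τ) : ∀ θ ∈ sem (subst s e),
      Judge (semEnv G) (fun α x => sem (s α x)) e θ := by
  induction e with
  | @sym τ c =>
    intro θ hθ
    cases c with
    | terminal a =>
      have hb : headLabel (Term.head (Term.sym (Symbol.terminal a) : G.CTerm τ)) ≠ .bot := by
        simp [Term.head, headLabel]
      exact .terminal a θ (target_of_mem_sem_terminal hb hθ)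
        (mem_sem_terminal (fun α u hu => argSem_of_pInf hu) hb
          ⟨_, .refl, ComponentsRedexFree.redexFree trivial fun _ => hb⟩ hθ)
    | nonterminal F => exact .nonterminal F θ hθ
    | var x => exact .var x θ hθ
  | app e₁ e₂ ih₁ ih₂ =>
    intro θ hθ
    exact .app _ _ (argSem (subst s e₂)) θ (ih₁ _ (mem_sem_arr.2 (Or.inr ⟨_, θ, hθ, rfl⟩)))
      fun φ hφ => ih₂ φ (argSem_subset _ hφ)

theorem subst_noVar (s : ∀ α, NoVar α → G.CTerm α) {τ : Ty} (t : G.CTerm τ) :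
    subst s t = t := by
  induction t with
  | sym c =>
    cases c with
    | var x => exact x.elim
    | _ => rfl
  | app t₁ t₂ ih₁ ih₂ => rw [subst, ih₁, ih₂]

/-- If all arguments are normalizing, evaluating them first turns a full application of `F` into an
instance of its right-hand side, to which subject expansion applies. -/
theorem isWitness_semEnv : IsWitness (semEnv G) := by
  intro τ F θ h
  cases h with
  | inf_arrow_inf => exact Or.inl (Or.inl rfl)
  | nonterminal _ _ h =>
    by_cases hE : θ.ExistsArg (fun α σ => Atom.inf α ∈ σ)
    · exact Or.inl hE
    have hF : Normalizing (G := G) (Term.sym (.nonterminal F)) ∨ τ = .o := by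
      cases τ with
      | o => exact Or.inr rfl
      | arr a b => exact Or.inl (normalizing_sym_arr _)
    obtain ⟨s, q, rfl, hq⟩ := (mem_sem_cases (P := fun α σ => Atom.inf α ∈ σ)
      (fun α u hu => by rw [argSem_of_pInf hu]; rfl) h hF).resolve_left hE
    have hs : ∀ α x, ¬ PInf (s α x) := fun α x hx => hE <| Atom.existsArg_full_iff.2
      ⟨α, x, by rw [argSem_of_pInf hx]; rfl⟩
    -- with normal forms as arguments the redex is contracted by an IO step
    choose v hv hf using fun α x => not_not.1 fun h => hs α x ((pInf_iff _).2 h)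
    have hstep : IOSteps ((Term.sym (.nonterminal F)).applyArgs s) (subst v (G.rule F)) :=
      (IOSteps.applyArgs s v .refl hv).tail (.redex F v hf)
    rw [hstep.sem_eq] at hq
    refine Or.inr ⟨_, q, rfl, ?_⟩
    have : (fun α x => argSem (s α x)) = fun α x => sem (v α x) := by
      funext α x
      rw [argSem_of_not_pInf (hs α x), IOSteps.sem_eq (hv α x)]
    rw [this]
    exact judge_of_mem_sem v _ _ hq

theorem matches_of_mem_sem {τ : Ty} {t : G.CTerm τ} {θ : Atom τ} (h : θ ∈ sem t) :
    Matches t {θ} := by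
  refine ⟨semEnv G, isWitness_semEnv, ?_⟩
  rintro φ rfl
  -- `t` is its own instance, under the empty substitution
  have he : (noVarEnv : Env NoVar) = fun α x => sem (Term.sym (.var x) : G.CTerm α) := by
    funext α x
    exact x.elim
  rw [he]
  refine judge_of_mem_sem (fun α x => Term.sym (.var x)) t _ ?_
  rwa [subst_noVar]

end HORS
end RecScheme

theorem mainTheorem3 (G : RecScheme.HORS) {τ : RecScheme.Ty} (t : G.CTerm τ) :
    (RecScheme.HORS.MatchesAtom t .inf ↔ RecScheme.HORS.PInf t) ∧
    (RecScheme.HORS.MatchesAtom t .bot ↔ RecScheme.HORS.PBot t) := by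
  open RecScheme HORS in
  constructor
  · constructor
    · rintro ⟨θ, hθ, Θ, hΘ, h⟩
      cases hθ
      exact hΘ.pInf_of_judge (h _ rfl)
    · exact fun h => ⟨_, rfl, matches_of_mem_sem (inf_mem_sem.2 h)⟩
  · cases τ with
    | o =>
      constructor
      · rintro ⟨θ, hθ, Θ, hΘ, h⟩
        cases hθ
        exact hΘ.pBot_of_judge (h _ rfl)
      · exact fun h => ⟨_, rfl, matches_of_mem_sem (mem_sem_o.2 (Or.inr ⟨rfl, h⟩))⟩
    | arr a b =>
      constructor
      · rintro ⟨θ, hθ, -⟩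
        cases hθ
      · exact False.elim
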